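/- Let $\langle Z,W\rangle = W^*JZ$ be the Hermitian form of signature $(2,1)$ on $\mathbb{C}^3$ with $J=\begin{pmatrix}0&0&1\\0&1&0\\1&0&0\end{pmatrix}$, let $\pi$ denote projectivization, and let $\mathbb{H}^2_{\mathbb{C}}\subset\mathbb{CP}^2$ be the set of negative lines. Its boundary $\partial_\infty\mathbb{H}^2_{\mathbb C}$ is the set of null lines; put $\infty=\pi((1,0,0)^T)$. For $z\in\mathbb{C}$, $v\in\mathbb{R}$, $u\ge 0$ let $\psi(z,v,u)=\left(\frac{-|z|^2-u+iv}{2},z,1\right)^T$; the $(z,v,u)$ are the horospherical coordinates of $\pi(\psi(z,v,u))$. For $u_0>0$ the open horoball of height $u_0$ based at $\infty$ is $B_{u_0}=\{\pi(\psi(z,v,u)) : z\in\mathbb{C}, v\in\mathbb{R}, u>u_0\}$. Let $\mathcal{O}_2$ be the ring of integers of $\mathbb{Q}(i\sqrt2)$ and $\Gamma(2)=\mathrm{PU}(2,1;\mathcal{O}_2)$ the projective image of the group of matrices in $\mathrm{GL}(3,\mathcal{O}_2)$ that preserve the form. The covering height $u^{cov}$ of $\Gamma(2)$ is the supremum of the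 heights $u>0$ such that the $\Gamma(2)$-translates of $B_u$ cover $\mathbb{H}^2_{\mathbb{C}}$, and the covering depth of $\Gamma(2)$ is the integer $n\ge1$ with $\frac{2}{\sqrt{n+1}}<u^{cov}\le\frac{2}{\sqrt n}$. The depth of an $\mathcal{O}_2$-rational point $p\in\partial_\infty\mathbb{H}^2_{\mathbb C}$ is $|\langle P,Q\rangle|^2$ for any primitive integral lifts $P,Q\in\mathcal{O}_2^3$ of $p$ and $\infty$. The extended Cygan ball $B((z_0,v_0),r)$ is the set of all $(z,v,u)$ with $u\ge0$ and $\left((|z-z_0|^2+u)^2+|v-v_0+2\,\mathrm{Im}(z\bar z_0)|^2\right)^{1/4}<r$. Let $D_\infty(2)\subset\mathbb{C}\times\mathbb{R}$ be the convex hull of $(0,0)$, $(2,0)$, $(i\sqrt2,0)$, $(0,2\sqrt2)$, $(2,2\sqrt2)$, $(i\sqrt2,2\sqrt2)$. **Corollary 3.** Let $u=0.4852$. Then: 1. $\frac{2}{\sqrt{17}}<u$, and the $\Gamma(2)$-translates of $B_u$ cover $\mathbb{H}^2_{\mathbb{C}}$. 2. The covering depth of $\Gamma(2)$ exists, is unique,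 and is at most $16$. 3. The points $(0,0)$, $(0,2\sqrt2)$, $(2,0)$, $(2,2\sqrt2)$, $(i\sqrt2,0)$, $(i\sqrt2,2\sqrt2)$ are $\mathcal{O}_2$-rational of depth $1$, and $(\frac23+\frac13i\sqrt2,\frac23\sqrt2)$, $(\frac43+\frac13i\sqrt2,2\sqrt2)$ are $\mathcal{O}_2$-rational of depth $3$ (as boundary points with $u=0$). The prism $D_\infty(2)\times\{u\}$ is the union of eight affine convex hulls of finite sets, the $i$-th of which is contained in the extended Cygan ball centred at the $i$-th of these eight points, with radius $(4/n)^{1/4}$ where $n\in\{1,3\}$ is its depth (so $\sqrt2$ for depth $1$ and $(4/3)^{1/4}$ for depth $3$). -/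

import Mathlib

noncomputable section

open Complex
open scoped Matrix MatrixGroups LinearAlgebra.Projectivization

namespace PicardModular

/-! ### The Siegel model of complex hyperbolic 2-space -/

/-- The matrix of the Hermitian form of signature `(2,1)`. -/
def formMatrix : Matrix (Fin 3) (Fin 3) ℂ :=
  !![0, 0, 1; 0, 1, 0; 1, 0, 0]

/-- The Hermitian form `⟨Z, W⟩ = W^* J Z` on `ℂ³`. -/
def herm (Z W : Fin 3 → ℂ) : ℂ := star W ⬝ᵥ (formMatrix *ᵥ Z)

/-- Complex hyperbolic 2-space: the negative lines in `ℂℙ²` (`⟨Z, Z⟩` is always real). -/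
def complexHyperbolicPlane : Set (ℙ ℂ (Fin 3 → ℂ)) :=
  {p | ∃ (Z : Fin 3 → ℂ) (hZ : Z ≠ 0), (herm Z Z).re < 0 ∧ p = Projectivization.mk ℂ Z hZ}

/-- The boundary at infinity: the null lines in `ℂℙ²`. -/
def boundaryAtInfinity : Set (ℙ ℂ (Fin 3 → ℂ)) :=
  {p | ∃ (Z : Fin 3 → ℂ) (hZ : Z ≠ 0), herm Z Z = 0 ∧ p = Projectivization.mk ℂ Z hZ}

/-- The standard lift of the point with horospherical coordinates `w = ((z, v), u)`. -/
def stdLift (w : (ℂ × ℝ) × ℝ) : Fin 3 → ℂ :=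
  ![(-(‖w.1.1‖ : ℂ) ^ 2 - (w.2 : ℂ) + I * (w.1.2 : ℂ)) / 2, w.1.1, 1]

theorem stdLift_ne_zero (w : (ℂ × ℝ) × ℝ) : stdLift w ≠ 0 := by
  intro h
  have h2 := congrFun h 2
  simp [stdLift] at h2

/-- The projective point with horospherical coordinates `w = ((z, v), u)`, which lies in complex
hyperbolic space for `0 < u` and on the boundary at infinity for `u = 0`. -/
def horoPoint (w : (ℂ × ℝ) × ℝ) : ℙ ℂ (Fin 3 → ℂ) :=
  Projectivization.mk ℂ (stdLift w) (stdLift_ne_zero w)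

/-- The boundary point `∞ = π((1, 0, 0)ᵀ)`. -/
def pointAtInfinity : ℙ ℂ (Fin 3 → ℂ) :=
  Projectivization.mk ℂ ![1, 0, 0] (fun h => one_ne_zero (congrFun h 0))

/-- The open horoball of height `u₀` based at `∞`. -/
def horoball (u₀ : ℝ) : Set (ℙ ℂ (Fin 3 → ℂ)) :=
  {p | ∃ (z : ℂ) (v u : ℝ), u₀ < u ∧ p = horoPoint ((z, v), u)}

/-- The extended Cygan metric in horospherical coordinates. -/
def extCyganDist (w₁ w₂ : (ℂ × ℝ) × ℝ) : ℝ :=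
  ((‖w₁.1.1 - w₂.1.1‖ ^ 2 + |w₁.2 - w₂.2|) ^ 2
    + |w₁.1.2 - w₂.1.2 + 2 * (w₁.1.1 * (starRingEnd ℂ) w₂.1.1).im| ^ 2) ^ (1 / 4 : ℝ)

/-- The open extended Cygan ball (in horospherical coordinates, `0 ≤ u`) of radius `r` centred at
the boundary point `p = (z, v)`. -/
def extCyganBall (p : ℂ × ℝ) (r : ℝ) : Set ((ℂ × ℝ) × ℝ) :=
  {w | 0 ≤ w.2 ∧ extCyganDist w (p, 0) < r}

/-! ### The Picard modular groups -/

/-- The ring of integers `𝓞_d` of the field `ℚ(i√d)`, as a subring of `ℂ`. -/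
def integerRing (d : ℕ) : Subring ℂ :=
  (integralClosure ℤ ℂ).toSubring ⊓
    (IntermediateField.adjoin ℚ {I * ((√(d : ℝ) : ℝ) : ℂ)}).toSubfield.toSubring

/-- `U(2,1)`: the invertible matrices that preserve the Hermitian form. -/
def unitary21 : Subgroup (GL (Fin 3) ℂ) where
  carrier := {A | ∀ Z W : Fin 3 → ℂ,
    herm ((A : Matrix (Fin 3) (Fin 3) ℂ) *ᵥ Z) ((A : Matrix (Fin 3) (Fin 3) ℂ) *ᵥ W) = herm Z W}
  one_mem' := by
    intro Z W
    simp
  mul_mem' := by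
    intro A B hA hB Z W
    simp only [Units.val_mul, ← Matrix.mulVec_mulVec]
    rw [hA, hB]
  inv_mem' := by
    intro A hA Z W
    rw [← hA]
    simp only [Matrix.mulVec_mulVec, ← Units.val_mul, mul_inv_cancel, Units.val_one,
      Matrix.one_mulVec]

/-- `U(2,1; 𝓞_d)`: the unitary matrices in `GL(3, 𝓞_d)`. -/
def integralUnitary21 (d : ℕ) : Subgroup (GL (Fin 3) ℂ) :=
  unitary21 ⊓ (Matrix.GeneralLinearGroup.map (n := Fin 3) (integerRing d).subtype).range

/-- The Picard modular group `Γ(d) = PU(2,1; 𝓞_d)`: the image of `U(2,1; 𝓞_d)` in `PGL(3, ℂ)`,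
with its projective action on `ℂℙ²`. -/
def picardModularGroup (d : ℕ) : Subgroup PGL(3, ℂ) :=
  (integralUnitary21 d).map Matrix.ProjGenLinGroup.mk

/-- The `Γ(d)`-translates of the open horoball of height `u` based at `∞` cover complex hyperbolic
2-space. -/
def HoroballTranslatesCover (d : ℕ) (u : ℝ) : Prop :=
  complexHyperbolicPlane ⊆ ⋃ γ ∈ picardModularGroup d, (fun x => γ • x) '' horoball u

/-- `h` is the covering height of `Γ(d)`: the least upper bound of the heights `u > 0` for which the
`Γ(d)`-translates of the horoball of height `u` cover. -/
def IsCoveringHeight (d : ℕ) (h : ℝ) : Prop :=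
  IsLUB {u : ℝ | 0 < u ∧ HoroballTranslatesCover d u} h

/-- `n` is a covering depth of `Γ(d)`: `2 / √(n+1) < h ≤ 2 / √n` for the covering height `h`. -/
def IsCoveringDepth (d n : ℕ) : Prop :=
  1 ≤ n ∧ ∃ h : ℝ, IsCoveringHeight d h ∧ 2 / √((n : ℝ) + 1) < h ∧ h ≤ 2 / √(n : ℝ)

/-! ### Levels and depths of rational boundary points -/

/-- `P` is a primitive integral vector: its coordinates are in `𝓞_d`, and it has no integral
submultiples other than those by units. -/
def IsPrimitiveIntegral (d : ℕ) (P : Fin 3 → ℂ) : Prop :=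
  (∀ i, P i ∈ integerRing d) ∧
    ∀ c ∈ integerRing d, c ≠ 0 → (∀ i, c⁻¹ * P i ∈ integerRing d) → c⁻¹ ∈ integerRing d

/-- `P` is a primitive integral lift of the projective point `p`. -/
def IsPrimitiveLift (d : ℕ) (p : ℙ ℂ (Fin 3 → ℂ)) (P : Fin 3 → ℂ) : Prop :=
  IsPrimitiveIntegral d P ∧ ∃ hP : P ≠ 0, p = Projectivization.mk ℂ P hP

/-- `p` and `q` are boundary points that have primitive integral lifts, and the level between them
is `l`: any two primitive integral lifts `P`, `Q` satisfy `|⟨P, Q⟩|² = l`. -/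
def HasLevel (d : ℕ) (p q : ℙ ℂ (Fin 3 → ℂ)) (l : ℝ) : Prop :=
  p ∈ boundaryAtInfinity ∧ q ∈ boundaryAtInfinity ∧
    (∃ P, IsPrimitiveLift d p P) ∧ (∃ Q, IsPrimitiveLift d q Q) ∧
    ∀ P Q, IsPrimitiveLift d p P → IsPrimitiveLift d q Q → ‖herm P Q‖ ^ 2 = l

/-- `p` is an `𝓞_d`-rational boundary point of depth `n`. -/
def HasDepth (d : ℕ) (p : ℙ ℂ (Fin 3 → ℂ)) (n : ℕ) : Prop :=
  HasLevel d p pointAtInfinity (n : ℝ)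

/-! ### The prism and the eight Cygan balls for `d = 2` -/

/-- The affine prism `D_∞(2)` in the Heisenberg group `ℂ × ℝ`. -/
def prism : Set (ℂ × ℝ) :=
  convexHull ℝ {(0, 0), (2, 0), (I * (√2 : ℝ), 0),
    (0, 2 * √2), (2, 2 * √2), (I * (√2 : ℝ), 2 * √2)}

/-- The centres of the eight extended Cygan balls. -/
def center : Fin 8 → ℂ × ℝ :=
  ![(0, 0), (0, 2 * √2), (2, 0), (2, 2 * √2), (I * (√2 : ℝ), 0), (I * (√2 : ℝ), 2 * √2),
    (2 / 3 + 1 / 3 * I * (√2 : ℝ), 2 / 3 * √2), (4 / 3 + 1 / 3 * I * (√2 : ℝ), 2 * √2)]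

/-- The depths of the eight centres. -/
def depth : Fin 8 → ℕ := ![1, 1, 1, 1, 1, 1, 3, 3]

end PicardModular

end

/-!
The covering rests on one formula: an element of `U(2,1; 𝓞₂)` whose inverse has first column `P`
moves a point with standard lift `X` and height `u` to height `u / |⟨X, P⟩| ^ 2`
(`exists_smul_horoPoint`).

If `P` is a primitive lift of a boundary point of depth `n` at extended Cygan distance `d` from that
point, then `|⟨X, P⟩| ^ 2 = n d ^ 4 / 4`, so the height increases exactly when `X` lies in the Cygan
ball of radius `(4 / n) ^ (1 / 4)`. Each of the eight centres is the image of `∞` under an explicit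
integral matrix (`cuspMatrix`), and the eight balls cover the prism at height `0.4852`, with a
little room to spare: `n d ^ 4 / 4 ≤ 0.999` (`depth_mul_cyganQuartic_le`). For fixed `(z, v)` the
distance `d` is increasing in the height, so the same bound holds below `0.4852`. The stabilizer of
`∞` moves every point over the prism (`exists_smul_mem_unitPrism`), hence a point of height at most
`0.4852` has a translate that is higher by the fixed factor `1 / 0.999`, and finitely many such
steps lead into the horoball. Thanks to the uniform factor, no discreteness of `Γ(2)` is needed.

That the balls cover the prism is a finite check. In suitable linear coordinates (`heis`) the balls
are convex at a fixed height (`convexOn_cyganQuartic_heis`), so a polytope lies in a ball as soon as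
its vertices do. The polytopes are found by cutting the triangular base of the prism into polygons
such that all vertical segments over one polygon run through the same list of balls; convexity
reduces this again to the vertices of the polygon (`convex_stack`), for which a table of heights is
given (`ladders`).

Conversely, the point `(-1, 0, 1)` of height `2` has an integral lift, and nonzero elements of `𝓞₂`
have absolute value at least `1`, so none of its translates is higher than `2`
(`lt_two_of_horoballTranslatesCover`). The covering height `h` therefore exists and satisfies
`0.4852 ≤ h ≤ 2`, and the covering depth is the integer part of `4 / h ^ 2`. Finally, a first column
of an integral unitary matrix is unimodular, which makes it primitive and determines all primitive
lifts up to units; this gives the depths (`hasDepth_of_column`).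
-/

noncomputable section

open Complex
open scoped Matrix MatrixGroups LinearAlgebra.Projectivization

namespace PicardModular

/-! ### The ring of integers of `ℚ(i√2)` -/

/-- The generator `i√2` of the ring `𝓞₂`. -/
def omega : ℂ := I * ((√((2 : ℕ) : ℝ) : ℝ) : ℂ)

theorem omega_eq : omega = I * ((√2 : ℝ) : ℂ) := by simp [omega]

theorem omega_mul_self : omega * omega = -2 := by
  have h : ((√2 : ℝ) : ℂ) * ((√2 : ℝ) : ℂ) = 2 := by
    rw [← ofReal_mul, Real.mul_self_sqrt (by norm_num)]; norm_num
  rw [omega_eq]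
  linear_combination (I * I) * h + 2 * I_mul_I

theorem omega_sq : omega ^ 2 = -2 := by rw [sq, omega_mul_self]

@[simp] theorem omega_re : omega.re = 0 := by simp [omega_eq]

@[simp] theorem omega_im : omega.im = √2 := by simp [omega_eq]

@[simp] theorem conj_omega : (starRingEnd ℂ) omega = -omega := by
  simp [omega_eq]

theorem exists_rat_of_mem_adjoin {x : ℂ}
    (hx : x ∈ IntermediateField.adjoin ℚ {omega}) : ∃ p q : ℚ, x = p + q * omega := by
  have hint : IsIntegral ℚ omega :=
    ⟨Polynomial.X ^ 2 + Polynomial.C 2, Polynomial.monic_X_pow_add_C _ two_ne_zero, by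
      simp [omega_sq]⟩
  rw [← IntermediateField.mem_toSubalgebra,
    IntermediateField.adjoin_simple_toSubalgebra_of_isAlgebraic hint.isAlgebraic] at hx
  induction hx using Algebra.adjoin_induction with
  | mem y hy => exact ⟨0, 1, by simp_all⟩
  | algebraMap r => exact ⟨r, 0, by simp⟩
  | add y z _ _ hy hz =>
    obtain ⟨p, q, rfl⟩ := hy
    obtain ⟨p', q', rfl⟩ := hz
    exact ⟨p + p', q + q', by push_cast; ring⟩
  | mul y z _ _ hy hz =>
    obtain ⟨p, q, rfl⟩ := hy
    obtain ⟨p', q', rfl⟩ := hz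
    refine ⟨p * p' - 2 * q * q', p * q' + q * p', ?_⟩
    push_cast
    linear_combination (q * q' : ℂ) * omega_mul_self

theorem exists_int_of_isIntegral {r : ℚ} (h : IsIntegral ℤ (r : ℂ)) : ∃ m : ℤ, r = m := by
  have h' : IsIntegral ℤ (algebraMap ℚ ℂ r) := by simpa using h
  rw [isIntegral_algebraMap_iff (algebraMap ℚ ℂ).injective] at h'
  obtain ⟨m, hm⟩ := IsIntegrallyClosed.isIntegral_iff.1 h'
  exact ⟨m, by simpa using hm.symm⟩

/-- The arithmetic behind `𝓞₂ = ℤ[i√2]`: trace and norm of `p + q i√2` determine integrality. -/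
theorem exists_int_of_trace_of_norm {p q : ℚ} {m k : ℤ} (hm : 2 * p = m)
    (hk : p ^ 2 + 2 * q ^ 2 = k) : ∃ a b : ℤ, p = a ∧ q = b := by
  have h8 : (4 * q) ^ 2 = ((2 * (4 * k - m ^ 2) : ℤ) : ℚ) := by
    push_cast; rw [← hm, ← hk]; ring
  obtain ⟨s, hs⟩ : ∃ s : ℤ, 4 * q = s := by
    apply exists_int_of_isIntegral
    have : IsIntegral ℤ (((4 * q : ℚ) : ℂ) ^ 2) := by
      have := (isIntegral_algebraMap (R := ℤ) (A := ℂ) (x := 2 * (4 * k - m ^ 2)))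
      convert this using 1
      rw [eq_intCast]
      exact_mod_cast h8
    exact this.of_pow two_pos
  rw [hs] at h8
  have h9 : s ^ 2 = 2 * (4 * k - m ^ 2) := by exact_mod_cast h8
  have hs2 : Even s := by
    rw [← Int.even_pow' two_ne_zero, h9]; exact even_two_mul _
  obtain ⟨t, rfl⟩ := hs2
  have h10 : m ^ 2 = 2 * (2 * k - t ^ 2) := by linarith
  have hm2 : Even m := by
    rw [← Int.even_pow' two_ne_zero, h10]; exact even_two_mul _
  obtain ⟨a, rfl⟩ := hm2
  have h11 : t ^ 2 = 2 * (k - a ^ 2) := by linarith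
  have ht2 : Even t := by
    rw [← Int.even_pow' two_ne_zero, h11]; exact even_two_mul _
  obtain ⟨b, rfl⟩ := ht2
  refine ⟨a, b, ?_, ?_⟩
  · push_cast at hm; linarith
  · push_cast at hs; linarith

theorem mem_integerRing_iff {x : ℂ} :
    x ∈ integerRing 2 ↔ ∃ m k : ℤ, x = m + k * omega := by
  have hω : IsIntegral ℤ omega :=
    ⟨Polynomial.X ^ 2 + Polynomial.C 2, Polynomial.monic_X_pow_add_C _ two_ne_zero, by
      simp [omega_sq]⟩
  constructor
  · rintro ⟨h1, h2⟩
    have hint : IsIntegral ℤ x := h1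
    obtain ⟨p, q, rfl⟩ := exists_rat_of_mem_adjoin (x := x) h2
    have hconj : IsIntegral ℤ ((p : ℂ) - q * omega) := by
      have := hint.map (starRingEnd ℂ).toIntAlgHom
      simpa [sub_eq_add_neg] using this
    obtain ⟨m, hm⟩ : ∃ m : ℤ, 2 * p = m := by
      apply exists_int_of_isIntegral
      have h : ((2 * p : ℚ) : ℂ) = (p + q * omega) + (p - q * omega) := by push_cast; ring
      exact h ▸ hint.add hconj
    obtain ⟨k, hk⟩ : ∃ k : ℤ, p ^ 2 + 2 * q ^ 2 = k := by
      apply exists_int_of_isIntegral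
      have h : ((p ^ 2 + 2 * q ^ 2 : ℚ) : ℂ) = (p + q * omega) * (p - q * omega) := by
        push_cast
        linear_combination (q ^ 2 : ℂ) * omega_mul_self
      exact h ▸ hint.mul hconj
    obtain ⟨a, b, rfl, rfl⟩ := exists_int_of_trace_of_norm hm hk
    exact ⟨a, b, by simp⟩
  · rintro ⟨m, k, rfl⟩
    refine ⟨?_, ?_⟩
    · change IsIntegral ℤ _
      have hm : ∀ n : ℤ, IsIntegral ℤ (n : ℂ) := fun n => by
        simpa using isIntegral_algebraMap (R := ℤ) (A := ℂ) (x := n)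
      exact (hm m).add ((hm k).mul hω)
    · change (m + k * omega : ℂ) ∈ IntermediateField.adjoin ℚ {omega}
      exact add_mem (intCast_mem _ _) (mul_mem (intCast_mem _ _)
        (IntermediateField.mem_adjoin_simple_self ℚ omega))

theorem omega_mem : omega ∈ integerRing 2 := mem_integerRing_iff.2 ⟨0, 1, by simp⟩

theorem conj_mem_integerRing {x : ℂ} (hx : x ∈ integerRing 2) :
    (starRingEnd ℂ) x ∈ integerRing 2 := by
  obtain ⟨m, k, rfl⟩ := mem_integerRing_iff.1 hx
  exact mem_integerRing_iff.2 ⟨m, -k, by simp⟩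

theorem normSq_int_add_omega (a b : ℝ) : ‖(a + b * omega : ℂ)‖ ^ 2 = a ^ 2 + 2 * b ^ 2 := by
  rw [← Complex.normSq_eq_norm_sq, Complex.normSq_apply]
  simp
  nlinarith [Real.mul_self_sqrt (show (0 : ℝ) ≤ 2 by norm_num)]

theorem one_le_normSq_of_mem_integerRing {x : ℂ} (hx : x ∈ integerRing 2) (h0 : x ≠ 0) :
    1 ≤ ‖x‖ ^ 2 := by
  obtain ⟨m, k, rfl⟩ := mem_integerRing_iff.1 hx
  have h := normSq_int_add_omega m k
  push_cast at h
  rw [h]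
  have hpos : 0 < m ^ 2 + 2 * k ^ 2 := by
    rcases eq_or_ne m 0 with rfl | hm
    · have hk : k ≠ 0 := by rintro rfl; simp at h0
      positivity
    · positivity
  exact_mod_cast hpos

/-! ### Lifts, heights and the action of the Picard modular group -/

theorem herm_apply (Z W : Fin 3 → ℂ) :
    herm Z W = Z 0 * (starRingEnd ℂ) (W 2) + Z 1 * (starRingEnd ℂ) (W 1)
      + Z 2 * (starRingEnd ℂ) (W 0) := by
  simp [herm, formMatrix, Matrix.mulVec, dotProduct, Fin.sum_univ_three]
  ring

theorem herm_smul_right (c : ℂ) (Z W : Fin 3 → ℂ) :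
    herm Z (c • W) = (starRingEnd ℂ) c * herm Z W := by
  simp [herm_apply]; ring

theorem herm_smul_smul (c : ℂ) (Z : Fin 3 → ℂ) :
    herm (c • Z) (c • Z) = (‖c‖ ^ 2 : ℝ) * herm Z Z := by
  rw [← Complex.normSq_eq_norm_sq, Complex.normSq_eq_conj_mul_self]
  simp [herm_apply]; ring

theorem stdLift_zero_re (w : (ℂ × ℝ) × ℝ) :
    (stdLift w 0).re = (-(w.1.1.re ^ 2 + w.1.1.im ^ 2) - w.2) / 2 := by
  have h : ((‖w.1.1‖ : ℂ) ^ 2).re = w.1.1.re ^ 2 + w.1.1.im ^ 2 := by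
    rw [← ofReal_pow, ofReal_re, ← Complex.normSq_eq_norm_sq, Complex.normSq_apply]; ring
  simp [stdLift, h]

theorem stdLift_zero_im (w : (ℂ × ℝ) × ℝ) : (stdLift w 0).im = w.1.2 / 2 := by
  have h : ((‖w.1.1‖ : ℂ) ^ 2).im = 0 := by
    rw [← ofReal_pow, ofReal_im]
  simp [stdLift, h]

@[simp] theorem stdLift_one (w : (ℂ × ℝ) × ℝ) : stdLift w 1 = w.1.1 := rfl

@[simp] theorem stdLift_two (w : (ℂ × ℝ) × ℝ) : stdLift w 2 = 1 := rfl

theorem herm_stdLift_self (w : (ℂ × ℝ) × ℝ) : herm (stdLift w) (stdLift w) = -(w.2 : ℂ) := by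
  rw [herm_apply]
  apply Complex.ext
  · simp [stdLift_zero_re]; ring
  · simp; ring

/-- A vector of the hyperplane `Z 2 = 0`, the orthogonal complement of `∞`, is never negative. -/
theorem apply_two_ne_zero {Z : Fin 3 → ℂ} (h : (herm Z Z).re < 0) : Z 2 ≠ 0 := by
  intro h2
  rw [herm_apply, h2, Complex.mul_conj] at h
  simp at h
  exact absurd h (not_lt.2 (Complex.normSq_nonneg _))

/-- Horospherical coordinates of a line with a given lift `Z`: the height is `-⟨Z, Z⟩ / |Z 2| ^ 2`.
-/
theorem exists_mk_eq_horoPoint {Z : Fin 3 → ℂ} (hZ : Z ≠ 0) (h2 : Z 2 ≠ 0) :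
    ∃ (z : ℂ) (v : ℝ),
      Projectivization.mk ℂ Z hZ = horoPoint ((z, v), -(herm Z Z).re / ‖Z 2‖ ^ 2) := by
  refine ⟨Z 1 / Z 2, 2 * (Z 0 / Z 2).im, ?_⟩
  rw [horoPoint, Projectivization.mk_eq_mk_iff']
  refine ⟨Z 2, ?_⟩
  have hre : (herm Z Z).re / ‖Z 2‖ ^ 2 = 2 * (Z 0 / Z 2).re + ‖Z 1 / Z 2‖ ^ 2 := by
    have hn : Complex.normSq (Z 2) ≠ 0 := by simpa using h2
    rw [herm_apply, norm_div, div_pow, ← Complex.normSq_eq_norm_sq, ← Complex.normSq_eq_norm_sq,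
      Complex.div_re, Complex.mul_conj]
    field_simp
    simp
    ring
  have key : (stdLift ((Z 1 / Z 2, 2 * (Z 0 / Z 2).im), -(herm Z Z).re / ‖Z 2‖ ^ 2)) 0
      = Z 0 / Z 2 := by
    rw [neg_div, hre]
    apply Complex.ext
    · rw [stdLift_zero_re, ← Complex.normSq_eq_norm_sq, Complex.normSq_apply]; ring
    · rw [stdLift_zero_im]; ring
  funext i
  fin_cases i
  · simp only [Pi.smul_apply, Fin.zero_eta, key, smul_eq_mul]
    field_simp
  · simp [stdLift]; field_simp
  · simp [stdLift]

theorem exists_horoPoint_of_mem_complexHyperbolicPlane {p : ℙ ℂ (Fin 3 → ℂ)}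
    (hp : p ∈ complexHyperbolicPlane) : ∃ w : (ℂ × ℝ) × ℝ, 0 < w.2 ∧ p = horoPoint w := by
  obtain ⟨Z, hZ, hneg, rfl⟩ := hp
  have h2 := apply_two_ne_zero hneg
  obtain ⟨z, v, h⟩ := exists_mk_eq_horoPoint hZ h2
  exact ⟨_, div_pos (neg_pos.2 hneg) (by positivity), h⟩

/-- A matrix over `𝓞₂` satisfying `M^* J M = J` is invertible over `𝓞₂`, with inverse
`J M^* J`. -/
theorem exists_mem_integralUnitary21 (M : Matrix (Fin 3) (Fin 3) ℂ)
    (hM : ∀ i j, M i j ∈ integerRing 2) (hJ : Mᴴ * formMatrix * M = formMatrix) :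
    ∃ g ∈ integralUnitary21 2, (g : Matrix (Fin 3) (Fin 3) ℂ) = M := by
  have hJJ : formMatrix * formMatrix = 1 := by
    ext i j
    fin_cases i <;> fin_cases j <;> simp [formMatrix, Matrix.mul_apply, Fin.sum_univ_three]
  have hinv : (formMatrix * Mᴴ * formMatrix) * M = 1 := by
    rw [Matrix.mul_assoc formMatrix, Matrix.mul_assoc formMatrix, hJ, hJJ]
  have hmem : ∀ i j, (formMatrix * Mᴴ * formMatrix) i j ∈ integerRing 2 := by
    intro i j
    fin_cases i <;> fin_cases j <;>
      simpa [formMatrix, Matrix.mul_apply, Matrix.vecMul, dotProduct, Fin.sum_univ_three]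
        using conj_mem_integerRing (hM _ _)
  let A : Matrix (Fin 3) (Fin 3) (integerRing 2) := fun i j => ⟨M i j, hM i j⟩
  let B : Matrix (Fin 3) (Fin 3) (integerRing 2) := fun i j => ⟨_, hmem i j⟩
  have hA : A.map (integerRing 2).subtype = M := rfl
  have hB : B.map (integerRing 2).subtype = formMatrix * Mᴴ * formMatrix := rfl
  have hBA : B * A = 1 := by
    have hinj : Function.Injective
        (fun C : Matrix (Fin 3) (Fin 3) (integerRing 2) => C.map (integerRing 2).subtype) :=
      Matrix.map_injective Subtype.val_injective
    apply hinj
    simp only [Matrix.map_mul, hA, hB, hinv, Matrix.map_one _ (map_zero _) (map_one _)]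
  let g : GL (Fin 3) (integerRing 2) := ⟨A, B, mul_eq_one_comm.1 hBA, hBA⟩
  refine ⟨Matrix.GeneralLinearGroup.map (integerRing 2).subtype g, ⟨?_, g, rfl⟩, hA⟩
  intro Z W
  have hg : ((Matrix.GeneralLinearGroup.map (integerRing 2).subtype g : GL (Fin 3) ℂ) :
      Matrix (Fin 3) (Fin 3) ℂ) = M := hA
  rw [hg, herm, herm, Matrix.star_mulVec, ← Matrix.dotProduct_mulVec, Matrix.mulVec_mulVec,
    Matrix.mulVec_mulVec, hJ]

theorem apply_mem_integerRing {g : GL (Fin 3) ℂ} (hg : g ∈ integralUnitary21 2) (i j : Fin 3) :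
    (g : Matrix (Fin 3) (Fin 3) ℂ) i j ∈ integerRing 2 := by
  obtain ⟨-, A, rfl⟩ := hg
  exact ((A : Matrix (Fin 3) (Fin 3) (integerRing 2)) i j).2

theorem mk_mem_picardModularGroup {g : GL (Fin 3) ℂ} (hg : g ∈ integralUnitary21 2) :
    Matrix.ProjGenLinGroup.mk g ∈ picardModularGroup 2 :=
  Subgroup.mem_map_of_mem _ hg

theorem mk_smul_horoPoint (g : GL (Fin 3) ℂ) (w : (ℂ × ℝ) × ℝ) :
    ∃ h, Matrix.ProjGenLinGroup.mk g • horoPoint w =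
      Projectivization.mk ℂ ((g : Matrix (Fin 3) (Fin 3) ℂ) *ᵥ stdLift w) h :=
  ⟨_, Projectivization.PGL.mk_smul_mk g (stdLift_ne_zero w)⟩

/-- The inverse of an element of `U(2,1; 𝓞₂)` with first column `P` turns the height `u` of a point
with standard lift `X` into `u / |⟨X, P⟩| ^ 2`. -/
theorem exists_smul_horoPoint {g : GL (Fin 3) ℂ} (hg : g ∈ integralUnitary21 2)
    {w : (ℂ × ℝ) × ℝ} (hw : 0 < w.2) :
    ∃ (z : ℂ) (v : ℝ), Matrix.ProjGenLinGroup.mk g⁻¹ • horoPoint w =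
      horoPoint ((z, v),
        w.2 / ‖herm (stdLift w) (fun i => (g : Matrix (Fin 3) (Fin 3) ℂ) i 0)‖ ^ 2) := by
  obtain ⟨h0, h⟩ := mk_smul_horoPoint g⁻¹ w
  set Z := ((g⁻¹ : GL (Fin 3) ℂ) : Matrix (Fin 3) (Fin 3) ℂ) *ᵥ stdLift w with hZ
  have hgZ : (g : Matrix (Fin 3) (Fin 3) ℂ) *ᵥ Z = stdLift w := by
    rw [hZ, Matrix.mulVec_mulVec, ← Units.val_mul, mul_inv_cancel, Units.val_one,
      Matrix.one_mulVec]
  have hself : herm Z Z = -(w.2 : ℂ) := by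
    rw [← herm_stdLift_self, ← hgZ]; exact (hg.1 Z Z).symm
  have hcol : Z 2 = herm (stdLift w) (fun i => (g : Matrix (Fin 3) (Fin 3) ℂ) i 0) := by
    have hc : (fun i => (g : Matrix (Fin 3) (Fin 3) ℂ) i 0)
        = (g : Matrix (Fin 3) (Fin 3) ℂ) *ᵥ ![1, 0, 0] := by
      funext i; simp [Matrix.mulVec, dotProduct, Fin.sum_univ_three]
    rw [hc, ← hgZ]
    exact ((hg.1 Z ![1, 0, 0]).trans (by simp [herm_apply])).symm
  have h2 : Z 2 ≠ 0 := apply_two_ne_zero (by rw [hself]; simpa using hw)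
  obtain ⟨z, v, hzv⟩ := exists_mk_eq_horoPoint h0 h2
  refine ⟨z, v, ?_⟩
  rw [h, hzv, hself, ← hcol]
  simp

/-! ### Extended Cygan distances -/

/-- The fourth power of the extended Cygan distance between `w` and the boundary point `p`. -/
def cyganQuartic (w : (ℂ × ℝ) × ℝ) (p : ℂ × ℝ) : ℝ :=
  (‖w.1.1 - p.1‖ ^ 2 + w.2) ^ 2 + (w.1.2 - p.2 + 2 * (w.1.1 * (starRingEnd ℂ) p.1).im) ^ 2

theorem cyganQuartic_nonneg (w : (ℂ × ℝ) × ℝ) (p : ℂ × ℝ) : 0 ≤ cyganQuartic w p := by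
  unfold cyganQuartic; positivity

theorem extCyganDist_eq {w : (ℂ × ℝ) × ℝ} (hw : 0 ≤ w.2) (p : ℂ × ℝ) :
    extCyganDist w (p, 0) = cyganQuartic w p ^ (1 / 4 : ℝ) := by
  simp [extCyganDist, cyganQuartic, abs_of_nonneg hw]

theorem norm_herm_stdLift_sq (w : (ℂ × ℝ) × ℝ) (p : ℂ × ℝ) :
    ‖herm (stdLift w) (stdLift (p, 0))‖ ^ 2 = cyganQuartic w p / 4 := by
  rw [cyganQuartic, ← Complex.normSq_eq_norm_sq, ← Complex.normSq_eq_norm_sq, herm_apply,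
    Complex.normSq_apply, Complex.normSq_apply]
  simp [stdLift_zero_re, stdLift_zero_im]
  ring

/-! ### The eight centres and their depths -/

/-- Elements of `U(2,1; 𝓞₂)` whose first columns are lifts of the eight centres, i.e. which map `∞`
to the eight centres. -/
def cuspMatrix : Fin 8 → Matrix (Fin 3) (Fin 3) ℂ :=
  ![!![0, 0, 1; 0, 1, 0; 1, 0, 0],
    !![omega, 0, 1; 0, 1, 0; 1, 0, 0],
    !![-2, -2, 1; 2, 1, 0; 1, 0, 0],
    !![-2 + omega, -2, 1; 2, 1, 0; 1, 0, 0],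
    !![-1, omega, 1; omega, 1, 0; 1, 0, 0],
    !![-1 + omega, omega, 1; omega, 1, 0; 1, 0, 0],
    !![-1, 0, 0; omega, 1, 0; 1 + omega, -omega, -1],
    !![1 + 2 * omega, -2 * omega, -omega; 2 - omega, -3, -2; 1 - omega, omega - 2, -1 + omega]]

theorem cuspMatrix_mem_integerRing (i : Fin 8) (j k : Fin 3) :
    cuspMatrix i j k ∈ integerRing 2 := by
  have h2 : (2 : ℂ) ∈ integerRing 2 := ofNat_mem _ 2
  have h3 : (3 : ℂ) ∈ integerRing 2 := ofNat_mem _ 3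
  have hω := omega_mem
  fin_cases i <;> fin_cases j <;> fin_cases k <;> simp [cuspMatrix] <;>
    first
    | assumption
    | exact add_mem (neg_mem h2) hω
    | exact add_mem (neg_mem (one_mem _)) hω
    | exact add_mem (one_mem _) hω
    | exact add_mem (one_mem _) (mul_mem h2 hω)
    | exact mul_mem h2 hω
    | exact sub_mem h2 hω
    | exact sub_mem (one_mem _) hω
    | exact sub_mem hω h2

theorem exists_cuspMatrix_mem_integralUnitary21 (i : Fin 8) :
    ∃ g ∈ integralUnitary21 2, (g : Matrix (Fin 3) (Fin 3) ℂ) = cuspMatrix i := by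
  refine exists_mem_integralUnitary21 _ (cuspMatrix_mem_integerRing i) ?_
  have h2 : (starRingEnd ℂ) 2 = 2 := Complex.conj_ofNat 2
  have h3 : (starRingEnd ℂ) 3 = 3 := Complex.conj_ofNat 3
  ext j k
  fin_cases i <;> fin_cases j <;> fin_cases k <;>
    simp [cuspMatrix, formMatrix, Matrix.mul_apply, Fin.sum_univ_three, h2, h3] <;>
    ring_nf <;> simp only [omega_sq] <;> norm_num

theorem cuspMatrix_two_zero_normSq (i : Fin 8) : ‖cuspMatrix i 2 0‖ ^ 2 = depth i := by
  have h := normSq_int_add_omega 1 1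
  have h' := normSq_int_add_omega 1 (-1)
  norm_num at h h'
  fin_cases i <;> simp [cuspMatrix, depth, h]
  rw [sub_eq_add_neg, h']

theorem stdLift_boundary_zero (p : ℂ × ℝ) :
    stdLift (p, 0) 0 = (-(p.1 * (starRingEnd ℂ) p.1) + I * (p.2 : ℂ)) / 2 := by
  rw [Complex.mul_conj, Complex.normSq_eq_norm_sq]
  simp [stdLift]

theorem cuspMatrix_two_zero_smul_stdLift (i : Fin 8) :
    cuspMatrix i 2 0 • stdLift (center i, 0) = fun j => cuspMatrix i j 0 := by
  have h2 : (starRingEnd ℂ) 2 = 2 := Complex.conj_ofNat 2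
  have h3 : (starRingEnd ℂ) 3 = 3 := Complex.conj_ofNat 3
  have h4 : (starRingEnd ℂ) 4 = 4 := Complex.conj_ofNat 4
  have h5 : (starRingEnd ℂ) (1 / 3) = 1 / 3 := by rw [map_div₀, h3, map_one]
  have hs : ∀ c : ℂ, c * I * ((√2 : ℝ) : ℂ) = c * omega := fun c => by rw [omega_eq, mul_assoc]
  have hs1 : I * ((√2 : ℝ) : ℂ) = omega := omega_eq.symm
  have hs2 : I * (2 * ((√2 : ℝ) : ℂ)) = 2 * omega := by rw [omega_eq]; ring
  have hs3 : I * (2 / 3 * ((√2 : ℝ) : ℂ)) = 2 / 3 * omega := by rw [omega_eq]; ring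
  have h : omega ^ 2 = -2 := omega_sq
  have hc : omega ^ 3 = -2 * omega := by rw [pow_succ, h]
  funext j
  fin_cases j
  · simp only [Fin.zero_eta, Pi.smul_apply, smul_eq_mul, stdLift_boundary_zero]
    fin_cases i <;>
      simp [center, cuspMatrix, hs, hs1, hs2, hs3, h2, h3, h4, -map_inv₀] <;>
      ring_nf <;> simp only [h, hc, h5] <;> ring_nf
  · simp only [Fin.mk_one, Pi.smul_apply, smul_eq_mul, stdLift_one]
    fin_cases i <;>
      simp [center, cuspMatrix, hs, hs1] <;>
      ring_nf <;> simp only [h] <;> ring_nf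
  · simp

/-- The first column of an invertible matrix over `𝓞₂` is unimodular, hence it is the primitive
lift of a point, unique up to units. -/
theorem isPrimitiveLift_column {g : GL (Fin 3) ℂ} (hg : g ∈ integralUnitary21 2)
    {p : ℙ ℂ (Fin 3 → ℂ)} {h0 : (fun i => (g : Matrix (Fin 3) (Fin 3) ℂ) i 0) ≠ 0}
    (hp : p = Projectivization.mk ℂ (fun i => (g : Matrix (Fin 3) (Fin 3) ℂ) i 0) h0) :
    IsPrimitiveLift 2 p (fun i => (g : Matrix (Fin 3) (Fin 3) ℂ) i 0) ∧
    ∀ P, IsPrimitiveLift 2 p P → ∃ c : ℂ, ‖c‖ = 1 ∧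
      P = c • (fun i => (g : Matrix (Fin 3) (Fin 3) ℂ) i 0) := by
  set C : Fin 3 → ℂ := fun i => (g : Matrix (Fin 3) (Fin 3) ℂ) i 0 with hC
  have hCmem : ∀ i, C i ∈ integerRing 2 := fun i => apply_mem_integerRing hg i 0
  have hrow : ∀ j, ((g⁻¹ : GL (Fin 3) ℂ) : Matrix (Fin 3) (Fin 3) ℂ) 0 j ∈ integerRing 2 :=
    fun j => apply_mem_integerRing (inv_mem hg) 0 j
  have hbez : ∑ j, ((g⁻¹ : GL (Fin 3) ℂ) : Matrix (Fin 3) (Fin 3) ℂ) 0 j * C j = 1 := by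
    have h : ((g⁻¹ : GL (Fin 3) ℂ) : Matrix (Fin 3) (Fin 3) ℂ) * (g : Matrix (Fin 3) (Fin 3) ℂ)
        = 1 := by rw [← Units.val_mul, inv_mul_cancel, Units.val_one]
    have := congrFun (congrFun h 0) 0
    rwa [Matrix.mul_apply, Matrix.one_apply_eq] at this
  have hscal : ∀ c : ℂ, (∀ i, c * C i ∈ integerRing 2) → c ∈ integerRing 2 := by
    intro c hc
    have h1 : c = ∑ j, ((g⁻¹ : GL (Fin 3) ℂ) : Matrix (Fin 3) (Fin 3) ℂ) 0 j * (c * C j) := by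
      simp only [mul_left_comm _ c, ← Finset.mul_sum, hbez, mul_one]
    rw [h1]
    exact sum_mem fun j _ => mul_mem (hrow j) (hc j)
  refine ⟨⟨⟨hCmem, fun c _ _ h => hscal _ h⟩, h0, hp⟩, ?_⟩
  rintro P ⟨⟨hPmem, hPprim⟩, hP0, hP⟩
  rw [hp, eq_comm, Projectivization.mk_eq_mk_iff'] at hP
  obtain ⟨c, rfl⟩ := hP
  have hc0 : c ≠ 0 := by rintro rfl; simp at hP0
  have hc : c ∈ integerRing 2 := hscal c hPmem
  have hcinv : c⁻¹ ∈ integerRing 2 := hPprim c hc hc0 fun i => by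
    simpa [hc0] using hCmem i
  have h1 := one_le_normSq_of_mem_integerRing hc hc0
  have h2 := one_le_normSq_of_mem_integerRing hcinv (inv_ne_zero hc0)
  refine ⟨c, le_antisymm ?_ ?_, rfl⟩
  · rw [norm_inv, inv_pow] at h2
    have := (one_le_inv₀ (by positivity)).1 h2
    exact (sq_le_one_iff₀ (norm_nonneg _)).1 this
  · exact (one_le_sq_iff₀ (norm_nonneg _)).1 h1

/-- The image of `∞` under an element of `U(2,1; 𝓞₂)` has depth `|P 2| ^ 2`, where `P` is the first
column. -/
theorem hasDepth_of_column {g : GL (Fin 3) ℂ} (hg : g ∈ integralUnitary21 2)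
    {p : ℙ ℂ (Fin 3 → ℂ)} {h0 : (fun i => (g : Matrix (Fin 3) (Fin 3) ℂ) i 0) ≠ 0}
    (hp : p = Projectivization.mk ℂ (fun i => (g : Matrix (Fin 3) (Fin 3) ℂ) i 0) h0) {n : ℕ}
    (hn : ‖(g : Matrix (Fin 3) (Fin 3) ℂ) 2 0‖ ^ 2 = n) : HasDepth 2 p n := by
  have hcol : ∀ i, (((1 : GL (Fin 3) ℂ) : Matrix (Fin 3) (Fin 3) ℂ) i 0) = ![1, 0, 0] i := by
    intro i; fin_cases i <;> simp
  have hpair := isPrimitiveLift_column hg hp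
  have hinf := isPrimitiveLift_column (one_mem (integralUnitary21 2)) (p := pointAtInfinity)
    (h0 := fun h => one_ne_zero ((hcol 0).symm.trans (congrFun h 0))) (by
      simp only [pointAtInfinity, hcol])
  simp only [hcol] at hinf
  have hnull : herm (fun i => (g : Matrix (Fin 3) (Fin 3) ℂ) i 0)
      (fun i => (g : Matrix (Fin 3) (Fin 3) ℂ) i 0) = 0 := by
    have hc : (fun i => (g : Matrix (Fin 3) (Fin 3) ℂ) i 0)
        = (g : Matrix (Fin 3) (Fin 3) ℂ) *ᵥ ![1, 0, 0] := by
      funext i; simp [Matrix.mulVec, dotProduct, Fin.sum_univ_three]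
    rw [hc]
    exact (hg.1 _ _).trans (by simp [herm_apply])
  refine ⟨⟨_, h0, hnull, hp⟩, ⟨_, fun h => one_ne_zero (congrFun h 0), by simp [herm_apply], rfl⟩,
    ⟨_, hpair.1⟩, ⟨_, hinf.1⟩, ?_⟩
  intro P Q hP hQ
  obtain ⟨c, hc, rfl⟩ := hpair.2 P hP
  obtain ⟨d, hd, rfl⟩ := hinf.2 Q hQ
  rw [herm_smul_right, ← hn]
  simp [herm_apply, hc, hd]

theorem hasDepth_center (i : Fin 8) : HasDepth 2 (horoPoint (center i, 0)) (depth i) := by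
  obtain ⟨g, hg, hgM⟩ := exists_cuspMatrix_mem_integralUnitary21 i
  have hcol := cuspMatrix_two_zero_smul_stdLift i
  have hn := cuspMatrix_two_zero_normSq i
  rw [← hgM] at hcol hn
  have h2 : (g : Matrix (Fin 3) (Fin 3) ℂ) 2 0 ≠ 0 := by
    intro h
    rw [h] at hn
    fin_cases i <;> simp [depth] at hn
  refine hasDepth_of_column hg
    (h0 := by rw [← hcol]; exact smul_ne_zero h2 (stdLift_ne_zero _)) ?_ hn
  rw [horoPoint, Projectivization.mk_eq_mk_iff']
  exact ⟨((g : Matrix (Fin 3) (Fin 3) ℂ) 2 0)⁻¹, by rw [← hcol, inv_smul_smul₀ h2]⟩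

/-- An isometry taking the `i`-th centre to `∞` multiplies heights by
`(4 / n) / d ^ 4`, where `d` is the Cygan distance to the centre and `n` is its depth. -/
theorem exists_smul_horoPoint_of_center (i : Fin 8) {w : (ℂ × ℝ) × ℝ} (hw : 0 < w.2) :
    ∃ γ ∈ picardModularGroup 2, ∃ (z : ℂ) (v : ℝ),
      γ • horoPoint w = horoPoint ((z, v), w.2 / (depth i * cyganQuartic w (center i) / 4)) := by
  obtain ⟨g, hg, hgM⟩ := exists_cuspMatrix_mem_integralUnitary21 i
  obtain ⟨z, v, h⟩ := exists_smul_horoPoint hg hw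
  refine ⟨_, mk_mem_picardModularGroup (inv_mem hg), z, v, ?_⟩
  rw [h, hgM, ← cuspMatrix_two_zero_smul_stdLift, herm_smul_right, norm_mul, mul_pow,
    norm_herm_stdLift_sq, RCLike.norm_conj, cuspMatrix_two_zero_normSq, mul_div_assoc]

/-! ### An upper bound for the covering height -/

/-- Every translate of the point `(-1, 0, 1)` of height `2` has height at most `2`, because its
lift is integral: no horoball of height `2` or more has covering translates. -/
theorem lt_two_of_horoballTranslatesCover {u : ℝ} (hu : HoroballTranslatesCover 2 u) : u < 2 := by
  have hmem : horoPoint ((0, 0), 2) ∈ complexHyperbolicPlane :=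
    ⟨_, stdLift_ne_zero _, by rw [herm_stdLift_self]; simp, rfl⟩
  obtain ⟨γ, hγ, p, ⟨z, v, u', hu', rfl⟩, hp⟩ := Set.mem_iUnion₂.1 (hu hmem)
  obtain ⟨g, hg, rfl⟩ := hγ
  have hp' : Matrix.ProjGenLinGroup.mk g⁻¹ • horoPoint ((0, 0), 2) = horoPoint ((z, v), u') := by
    rw [← hp, map_inv, inv_smul_smul]
  obtain ⟨h0, h⟩ := mk_smul_horoPoint g⁻¹ ((0, 0), 2)
  rw [h, horoPoint, Projectivization.mk_eq_mk_iff'] at hp'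
  obtain ⟨c, hc⟩ := hp'
  have hself : herm (c • stdLift ((z, v), u')) (c • stdLift ((z, v), u')) = -2 := by
    rw [hc]
    refine ((inv_mem hg).1 _ _).trans ?_
    rw [herm_stdLift_self]; simp
  rw [herm_smul_smul, herm_stdLift_self] at hself
  have hcu : ‖c‖ ^ 2 * u' = 2 := by
    have : ‖c‖ ^ 2 * -u' = -2 := by exact_mod_cast hself
    linarith
  have hc0 : c ≠ 0 := by rintro rfl; simp at hcu
  have hcmem : c ∈ integerRing 2 := by
    have h2 := congrFun hc 2
    have hX : ∀ j, stdLift ((0, 0), 2) j ∈ integerRing 2 := by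
      intro j
      fin_cases j
      · simp [stdLift]
      · simp
      · simp
    simp only [Pi.smul_apply, stdLift_two, smul_eq_mul, mul_one] at h2
    rw [h2, Matrix.mulVec, dotProduct]
    exact sum_mem fun j _ => mul_mem (apply_mem_integerRing (inv_mem hg) 2 j) (hX j)
  have h1 := one_le_normSq_of_mem_integerRing hcmem hc0
  have h3 : 0 < u' := by
    by_contra! h
    nlinarith [sq_nonneg ‖c‖]
  nlinarith

/-! ### The stabilizer of the point at infinity -/

/-- Linear coordinates on `ℂ × ℝ` in which the prism is the standard one, with vertices in `ℤ³`:
`((a, b), c)` stands for `(2 a + i√2 b, 2√2 c)`. -/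
def heis : (ℝ × ℝ) × ℝ →ₗ[ℝ] ℂ × ℝ where
  toFun x := (2 * (x.1.1 : ℂ) + x.1.2 * omega, 2 * √2 * x.2)
  map_add' x y := by
    ext1
    · simp; ring
    · simp; ring
  map_smul' r x := by
    ext1
    · simp; ring
    · simp; ring

theorem heis_apply (x : (ℝ × ℝ) × ℝ) :
    heis x = (2 * (x.1.1 : ℂ) + x.1.2 * omega, 2 * √2 * x.2) := rfl

theorem heis_surjective (p : ℂ × ℝ) : ∃ x, heis x = p := by
  refine ⟨((p.1.re / 2, p.1.im / √2), p.2 / (2 * √2)), ?_⟩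
  ext1
  · apply Complex.ext
    · simp [heis_apply]; ring
    · simp [heis_apply]
  · simp [heis_apply]; field_simp

theorem mk_smul_horoPoint_eq {g : GL (Fin 3) ℂ} {w w' : (ℂ × ℝ) × ℝ}
    (h : (g : Matrix (Fin 3) (Fin 3) ℂ) *ᵥ stdLift w = stdLift w') :
    Matrix.ProjGenLinGroup.mk g • horoPoint w = horoPoint w' := by
  obtain ⟨h0, h1⟩ := mk_smul_horoPoint g w
  rw [h1, horoPoint]
  congr 1

/-- Heisenberg translations by `2 m + i√2 k` with vertical part `2√2 j` belong to `Γ(2)`. -/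
theorem exists_translation (m k j : ℤ) : ∃ γ ∈ picardModularGroup 2, ∀ a b c u : ℝ,
    γ • horoPoint (heis ((a, b), c), u)
      = horoPoint (heis ((a + m, b + k), c + j - 2 * (m * b - k * a)), u) := by
  obtain ⟨g, hg, hgM⟩ := exists_mem_integralUnitary21
    !![1, -(2 * m - k * omega), -(2 * (m * m) + k * k) + j * omega;
      0, 1, 2 * m + k * omega; 0, 0, 1] (by
      intro r s
      fin_cases r <;> fin_cases s <;> simp
      · exact mem_integerRing_iff.2 ⟨-(2 * m), k, by push_cast; ring⟩
      · exact mem_integerRing_iff.2 ⟨-(2 * (m * m) + k * k), j, by push_cast; ring⟩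
      · exact mem_integerRing_iff.2 ⟨2 * m, k, by push_cast; ring⟩) (by
      have h2 : (starRingEnd ℂ) 2 = 2 := Complex.conj_ofNat 2
      ext r s
      fin_cases r <;> fin_cases s <;>
        simp [formMatrix, Matrix.mul_apply, Fin.sum_univ_three, h2] <;> ring_nf
      simp only [omega_sq]
      ring)
  refine ⟨_, mk_mem_picardModularGroup hg, fun a b c u => ?_⟩
  refine mk_smul_horoPoint_eq ?_
  rw [hgM]
  funext r
  fin_cases r
  · apply Complex.ext
    · simp [Matrix.mulVec, dotProduct, Fin.sum_univ_three, stdLift_zero_re, heis_apply]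
      ring_nf
      simp only [Real.sq_sqrt (show (0 : ℝ) ≤ 2 by norm_num)]
      ring
    · simp [Matrix.mulVec, dotProduct, Fin.sum_univ_three, stdLift_zero_im, heis_apply]
      ring
  · simp [Matrix.mulVec, dotProduct, Fin.sum_univ_three, heis_apply]
    ring
  · simp [Matrix.mulVec, dotProduct, Fin.sum_univ_three]

/-- The half-turn `z ↦ -z` belongs to `Γ(2)`. -/
theorem exists_half_turn : ∃ γ ∈ picardModularGroup 2, ∀ a b c u : ℝ,
    γ • horoPoint (heis ((a, b), c), u) = horoPoint (heis ((-a, -b), c), u) := by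
  obtain ⟨g, hg, hgM⟩ := exists_mem_integralUnitary21 !![1, 0, 0; 0, -1, 0; 0, 0, 1] (by
      intro r s
      fin_cases r <;> fin_cases s <;> simp) (by
      ext r s
      fin_cases r <;> fin_cases s <;>
        simp [formMatrix, Matrix.mul_apply, Fin.sum_univ_three])
  refine ⟨_, mk_mem_picardModularGroup hg, fun a b c u => ?_⟩
  refine mk_smul_horoPoint_eq ?_
  rw [hgM]
  funext r
  fin_cases r
  · apply Complex.ext
    · simp [Matrix.mulVec, dotProduct, Fin.sum_univ_three, stdLift_zero_re, heis_apply]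
    · simp [Matrix.mulVec, dotProduct, Fin.sum_univ_three, stdLift_zero_im, heis_apply]
  · simp [Matrix.mulVec, dotProduct, Fin.sum_univ_three, heis_apply]
    ring
  · simp [Matrix.mulVec, dotProduct, Fin.sum_univ_three]

/-- The standard prism: the product of the standard triangle with the unit interval. -/
def unitPrism : Set ((ℝ × ℝ) × ℝ) :=
  {x | 0 ≤ x.1.1 ∧ 0 ≤ x.1.2 ∧ x.1.1 + x.1.2 ≤ 1 ∧ 0 ≤ x.2 ∧ x.2 ≤ 1}

/-- The prism is a fundamental domain for the stabilizer of `∞` in `Γ(2)`; translations reduce a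
point to a parallelogram, half of which a half-turn folds onto the triangular base. -/
theorem exists_smul_mem_unitPrism (w : (ℂ × ℝ) × ℝ) : ∃ γ ∈ picardModularGroup 2,
    ∃ x ∈ unitPrism, γ • horoPoint w = horoPoint (heis x, w.2) := by
  obtain ⟨⟨z, v⟩, u⟩ := w
  obtain ⟨⟨⟨a, b⟩, c⟩, h⟩ := heis_surjective (z, v)
  rw [← h]
  -- It suffices to bring the base point into the triangle: a vertical translation does the rest.
  suffices H : ∃ γ ∈ picardModularGroup 2, ∃ a' b' c' : ℝ, 0 ≤ a' ∧ 0 ≤ b' ∧ a' + b' ≤ 1 ∧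
      γ • horoPoint (heis ((a, b), c), u) = horoPoint (heis ((a', b'), c'), u) by
    obtain ⟨γ, hγ, a', b', c', ha, hb, hab, hγw⟩ := H
    obtain ⟨δ, hδ, hδw⟩ := exists_translation 0 0 (-⌊c'⌋)
    refine ⟨δ * γ, mul_mem hδ hγ, ((a', b'), Int.fract c'), ⟨ha, hb, hab, Int.fract_nonneg _,
      (Int.fract_lt_one _).le⟩, ?_⟩
    rw [mul_smul, hγw, hδw]
    simp [Int.fract, sub_eq_add_neg]
  obtain ⟨γ, hγ, hγw⟩ := exists_translation (-⌊a⌋) (-⌊b⌋) 0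
  have ha : a + ((-⌊a⌋ : ℤ) : ℝ) = Int.fract a := by simp [Int.fract, sub_eq_add_neg]
  have hb : b + ((-⌊b⌋ : ℤ) : ℝ) = Int.fract b := by simp [Int.fract, sub_eq_add_neg]
  by_cases hab : Int.fract a + Int.fract b ≤ 1
  · exact ⟨γ, hγ, _, _, _, Int.fract_nonneg a, Int.fract_nonneg b, hab, by rw [hγw, ha, hb]⟩
  · obtain ⟨ρ, hρ, hρw⟩ := exists_half_turn
    obtain ⟨δ, hδ, hδw⟩ := exists_translation 1 1 0
    refine ⟨δ * (ρ * γ), mul_mem hδ (mul_mem hρ hγ), _, _, _, ?_, ?_, ?_, by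
      rw [mul_smul, mul_smul, hγw, ha, hb, hρw, hδw]⟩
    · simpa using (Int.fract_lt_one a).le
    · simpa using (Int.fract_lt_one b).le
    · push_cast; linarith

/-! ### Vertical segments through convex sets -/

/-- Points `x` (base point and height) from which one can climb vertically to height `1` through
the sets `K i`, for `i` in the given list, taken in this order. -/
def stack {F : Type*} (K : Fin 8 → Set (F × ℝ)) : List (Fin 8) → Set (F × ℝ)
  | [] => {x | x.2 = 1}
  | i :: l => {x | x ∈ K i ∧ ∃ h, (x.1, h) ∈ K i ∧ (x.1, h) ∈ stack K l}

section Stack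

variable {F : Type*} [AddCommGroup F] [Module ℝ F] {K : Fin 8 → Set (F × ℝ)}

theorem convex_stack (hK : ∀ i, Convex ℝ (K i)) (l : List (Fin 8)) : Convex ℝ (stack K l) := by
  induction l with
  | nil =>
    intro x hx y hy p q _ _ hpq
    simp only [stack, Set.mem_ofPred_eq] at hx hy ⊢
    simp [hx, hy, hpq]
  | cons i l ih =>
    rintro x ⟨hx, h, hxh, hxl⟩ y ⟨hy, k, hyk, hyl⟩ p q hp hq hpq
    exact ⟨hK i hx hy hp hq hpq, p • h + q • k, hK i hxh hyk hp hq hpq, ih hxl hyl hp hq hpq⟩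

theorem exists_mem_of_mem_stack (hK : ∀ i, Convex ℝ (K i)) {l : List (Fin 8)} {x : F} {h c : ℝ}
    (hx : (x, h) ∈ stack K l) (hl : l ≠ []) (hc : h ≤ c) (hc1 : c ≤ 1) : ∃ i, (x, c) ∈ K i := by
  induction l generalizing h with
  | nil => exact absurd rfl hl
  | cons i l ih =>
    obtain ⟨hxi, k, hk, hkl⟩ := hx
    rcases le_or_gt c k with hck | hkc
    · refine ⟨i, ?_⟩
      have hseg : c ∈ segment ℝ h k := by rw [segment_eq_Icc (hc.trans hck)]; exact ⟨hc, hck⟩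
      obtain ⟨p, q, hp, hq, hpq, rfl⟩ := hseg
      have hmem := hK i hxi hk hp hq hpq
      simpa [← add_smul, hpq] using hmem
    · refine ih hkl ?_ hkc.le
      rintro rfl
      have : k = 1 := hkl
      linarith

end Stack

/-- Twice the signed area of a plane triangle. -/
def cross (p q r : ℝ × ℝ) : ℝ := (q.1 - p.1) * (r.2 - p.2) - (q.2 - p.2) * (r.1 - p.1)

theorem mem_of_triangle {C : Set (ℝ × ℝ)} (hC : Convex ℝ C) {p q r x : ℝ × ℝ} (hp : p ∈ C)
    (hq : q ∈ C) (hr : r ∈ C) (h : 0 < cross p q r) (h1 : 0 ≤ cross p q x) (h2 : 0 ≤ cross q r x)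
    (h3 : 0 ≤ cross r p x) : x ∈ C := by
  have hsum : cross q r x + cross r p x + cross p q x = cross p q r := by
    simp only [cross]; ring
  have hx : x = (cross q r x / cross p q r) • p + (cross r p x / cross p q r) • q
      + (cross p q x / cross p q r) • r := by
    have h' := h.ne'
    ext
    · simp only [Prod.fst_add, Prod.smul_fst, smul_eq_mul]
      field_simp
      simp only [cross]; ring
    · simp only [Prod.snd_add, Prod.smul_snd, smul_eq_mul]
      field_simp
      simp only [cross]; ring
  have hmem := hC.sum_mem (t := Finset.univ)
    (w := ![cross q r x / cross p q r, cross r p x / cross p q r, cross p q x / cross p q r])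
    (z := ![p, q, r])
    (by intro i _; fin_cases i <;> simp <;> positivity)
    (by
      simp only [Fin.sum_univ_three, Matrix.cons_val]
      rw [← add_div, ← add_div, hsum, div_self h.ne'])
    (by intro i _; fin_cases i <;> simpa)
  rw [hx]
  simpa [Fin.sum_univ_three] using hmem

/-! ### The polytopes covering the prism -/

/-- The combinatorial data of the covering. An entry `(σ, (a, b), [h₁, h₂, …])` describes the
vertical segment over the base point `(a / 24, b / 24)`: it is cut at the heights `h₁ / 72`,
`h₂ / 72`, …, and its successive pieces, from the bottom to the top, lie in the balls with numbers
`σ`. Base points with the same `σ` span a convex polygon, and the polygons cover the base. -/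
def ladders : List (List (Fin 8) × (ℤ × ℤ) × List ℤ) :=
  [([0, 6, 1], (0, 0), [24, 24, 72]),
    ([0, 6, 1], (12, 0), [30, 54, 72]),
    ([0, 6, 1], (13, 2), [26, 54, 72]),
    ([0, 6, 1], (12, 8), [18, 51, 72]),
    ([0, 6, 1], (10, 10), [18, 45, 72]),
    ([0, 6, 1], (0, 8), [25, 25, 72]),
    ([2, 6, 1], (12, 0), [30, 54, 72]),
    ([2, 6, 1], (13, 0), [33, 54, 72]),
    ([2, 6, 1], (13, 2), [25, 54, 72]),
    ([2, 3], (13, 0), [36, 72]),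
    ([2, 3], (24, 0), [36, 72]),
    ([2, 3], (17, 7), [0, 72]),
    ([2, 3], (14, 6), [0, 72]),
    ([2, 3], (13, 2), [24, 72]),
    ([0, 3, 6, 7], (13, 2), [24, 36, 67, 72]),
    ([0, 3, 6, 7], (14, 6), [0, 36, 54, 72]),
    ([0, 3, 6, 7], (12, 8), [12, 30, 48, 72]),
    ([0, 3, 6, 7], (12, 12), [3, 3, 36, 72]),
    ([3, 6, 7], (14, 6), [36, 54, 72]),
    ([3, 6, 7], (17, 7), [42, 54, 72]),
    ([3, 6, 7], (12, 12), [3, 36, 72]),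
    ([0, 6, 7, 1], (13, 2), [26, 67, 67, 72]),
    ([0, 6, 7, 1], (12, 12), [3, 36, 69, 72]),
    ([0, 6, 7, 1], (10, 14), [9, 30, 54, 72]),
    ([0, 6, 7, 1], (10, 10), [18, 36, 54, 72]),
    ([6, 4, 1], (0, 8), [24, 30, 72]),
    ([6, 4, 1], (10, 10), [45, 54, 72]),
    ([6, 4, 1], (10, 14), [33, 60, 72]),
    ([6, 4, 1], (7, 17), [12, 60, 72]),
    ([4, 5], (0, 8), [36, 72]),
    ([4, 5], (7, 17), [71, 72]),
    ([4, 5], (0, 24), [36, 72])]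

/-- The endpoints of those pieces of a vertical segment that are assigned to the ball `i`, where `h`
is the height at which the segment starts. -/
def rungs (i : Fin 8) (p : ℤ × ℤ) : ℤ → List (Fin 8) → List ℤ → List ((ℤ × ℤ) × ℤ)
  | h, j :: σ, k :: hs => (if j = i then [(p, h), (p, k)] else []) ++ rungs i p k σ hs
  | _, _, _ => []

/-- The vertices of the polytope assigned to the ball `i`. -/
def vertices (i : Fin 8) : List ((ℤ × ℤ) × ℤ) :=
  ladders.flatMap fun e => rungs i e.2.1 0 e.1 e.2.2

/-- The point of the unit prism encoded by integers. -/
def gridPoint (q : (ℤ × ℤ) × ℤ) : (ℝ × ℝ) × ℝ := ((q.1.1 / 24, q.1.2 / 24), q.2 / 72)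

/-- The polytope assigned to the ball `i`, in the coordinates of the unit prism. -/
def cell (i : Fin 8) : Set ((ℝ × ℝ) × ℝ) := convexHull ℝ (gridPoint '' {q | q ∈ vertices i})

theorem convex_cell (i : Fin 8) : Convex ℝ (cell i) := convex_convexHull ℝ _

/-- A list of heights that ends at the top and has as many entries as the list of balls. -/
def ReachesTop : List (Fin 8) → List ℤ → ℤ → Prop
  | [], [], h => h = 72
  | _ :: σ, k :: hs, _ => ReachesTop σ hs k
  | _, _, _ => False

instance decidableReachesTop : ∀ σ hs h, Decidable (ReachesTop σ hs h)
  | [], [], h => inferInstanceAs (Decidable (h = 72))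
  | _ :: σ, k :: hs, _ => decidableReachesTop σ hs k
  | [], _ :: _, _ => inferInstanceAs (Decidable False)
  | _ :: _, [], _ => inferInstanceAs (Decidable False)

theorem mem_stack_of_rungs {p : ℤ × ℤ} {σ : List (Fin 8)} {hs : List ℤ} {h : ℤ}
    (htop : ReachesTop σ hs h) (hr : ∀ i, ∀ q ∈ rungs i p h σ hs, q ∈ vertices i) :
    gridPoint (p, h) ∈ stack cell σ := by
  induction σ generalizing hs h with
  | nil =>
    cases hs with
    | nil =>
      have : h = 72 := htop
      simp [stack, gridPoint, this]
    | cons k hs => exact htop.elim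
  | cons j σ ih =>
    cases hs with
    | nil => exact htop.elim
    | cons k hs =>
      have hmem : ∀ q ∈ [(p, h), (p, k)], gridPoint q ∈ cell j := fun q hq =>
        subset_convexHull ℝ _ ⟨q, hr j q (by simp [rungs] at hq ⊢; tauto), rfl⟩
      exact ⟨hmem _ (by simp), k / 72, hmem (p, k) (by simp),
        ih htop fun i q hq => hr i q (by simp [rungs, hq])⟩

theorem mem_stack_of_mem_ladders {σ : List (Fin 8)} {p : ℤ × ℤ}
    (h : (σ, p) ∈ ladders.map fun e => (e.1, e.2.1)) :
    (((p.1 / 24, p.2 / 24), 0) : (ℝ × ℝ) × ℝ) ∈ stack cell σ := by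
  have hall : ∀ e ∈ ladders, ReachesTop e.1 e.2.2 0 := by decide
  obtain ⟨⟨σ', p', hs⟩, he, heq⟩ := List.mem_map.1 h
  obtain ⟨rfl, rfl⟩ := Prod.mk.inj heq
  have := mem_stack_of_rungs (p := p') (hall _ he)
    fun i q hq => List.mem_flatMap.2 ⟨_, he, hq⟩
  simpa [gridPoint] using this

theorem mem_stack_of_triangle (p q r : ℤ × ℤ) {σ : List (Fin 8)}
    (h : ∀ s ∈ [p, q, r], (σ, s) ∈ ladders.map fun e => (e.1, e.2.1)) {a b : ℝ}
    (hpos : 0 < (q.1 - p.1) * (r.2 - p.2) - (q.2 - p.2) * (r.1 - p.1))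
    (hab : 0 ≤ ((q.1 - p.1 : ℤ) : ℝ) * (24 * b - (p.2 : ℤ))
        - ((q.2 - p.2 : ℤ) : ℝ) * (24 * a - (p.1 : ℤ)) ∧
      0 ≤ ((r.1 - q.1 : ℤ) : ℝ) * (24 * b - (q.2 : ℤ))
        - ((r.2 - q.2 : ℤ) : ℝ) * (24 * a - (q.1 : ℤ)) ∧
      0 ≤ ((p.1 - r.1 : ℤ) : ℝ) * (24 * b - (r.2 : ℤ))
        - ((p.2 - r.2 : ℤ) : ℝ) * (24 * a - (r.1 : ℤ))) :
    ((a, b), (0 : ℝ)) ∈ stack cell σ := by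
  have hconv : Convex ℝ {x : ℝ × ℝ | (x, (0 : ℝ)) ∈ stack cell σ} := by
    intro x hx y hy s t hs ht hst
    have := convex_stack convex_cell σ hx hy hs ht hst
    simpa using this
  have hpos' : (0 : ℝ) < (q.1 - p.1) * (r.2 - p.2) - (q.2 - p.2) * (r.1 - p.1) := by
    exact_mod_cast hpos
  obtain ⟨h1, h2, h3⟩ := hab
  push_cast at h1 h2 h3
  refine mem_of_triangle hconv (x := (a, b)) (mem_stack_of_mem_ladders (h p (by simp)))
    (mem_stack_of_mem_ladders (h q (by simp))) (mem_stack_of_mem_ladders (h r (by simp)))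
    ?_ ?_ ?_ ?_ <;> simp only [cross] <;> linarith

/-- The polygons of base points with a common list of balls cover the triangular base. The base is
cut along lines until each piece lies in a triangle spanned by vertices of a single polygon. -/
theorem exists_mem_stack {a b : ℝ} (ha : 0 ≤ a) (hb : 0 ≤ b) (hab : a + b ≤ 1) :
    ∃ σ, ((a, b), (0 : ℝ)) ∈ stack cell σ := by
  rcases le_total 0 (-2 * a - 3 * b + 1) with h | h
  · exact ⟨[0, 6, 1], mem_stack_of_triangle (0, 0) (12, 0) (0, 8) (by decide)
      (by decide) (by push_cast; exact ⟨by linarith, by linarith, by linarith⟩)⟩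
  · rcases le_total 0 (27 * a - 21 * b + 7) with h | h
    · rcases le_total 0 (-168 * a + 96 * b + 91) with h | h
      · rcases le_total 0 (9 * a - 15 * b + 5) with h | h
        · rcases le_total 0 (12 * a - 5) with h | h
          · rcases le_total 0 (-10 * a - 2 * b + 5) with h | h
            · exact ⟨[0, 6, 1], mem_stack_of_triangle (0, 0) (12, 0) (10, 10) (by decide)
                (by decide) (by push_cast; exact ⟨by linarith, by linarith, by linarith⟩)⟩
            · rcases le_total 0 (-a + b) with h | h
              · exact ⟨[0, 6, 7, 1], mem_stack_of_triangle (12, 12) (10, 14) (10, 10) (by decide)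
                  (by decide) (by push_cast; exact ⟨by linarith, by linarith, by linarith⟩)⟩
              · rcases le_total 0 (-3 * a - 5 * b + 3) with h | h
                · rcases le_total 0 (-24 * a + 4 * b + 13) with h | h
                  · rcases le_total 0 (-2 * a + 1) with h | h
                    · exact ⟨[0, 6, 1], mem_stack_of_triangle (12, 0) (12, 8) (10, 10) (by decide)
                        (by decide) (by push_cast; exact ⟨by linarith, by linarith, by linarith⟩)⟩
                    · rcases le_total 0 (-18 * a - 3 * b + 10) with h | h
                      · rcases le_total 0 (-2 * a + b + 1) with h | h
                        · exact ⟨[0, 6, 1], mem_stack_of_triangle (12, 0) (13, 2) (12, 8) (by decide)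
                            (by decide) (by push_cast; exact ⟨by linarith, by linarith, by linarith⟩)⟩
                        · rcases le_total 0 (-24 * a + 13) with h | h
                          · exact ⟨[2, 6, 1], mem_stack_of_triangle (12, 0) (13, 0) (13, 2) (by decide)
                              (by decide) (by push_cast; exact ⟨by linarith, by linarith, by linarith⟩)⟩
                          · exact ⟨[2, 3], mem_stack_of_triangle (13, 0) (24, 0) (13, 2) (by decide)
                              (by decide) (by push_cast; exact ⟨by linarith, by linarith, by linarith⟩)⟩
                      · rcases le_total 0 (-48 * a + 12 * b + 25) with h | h
                        · exact ⟨[0, 3, 6, 7], mem_stack_of_triangle (13, 2) (14, 6) (12, 8) (by decide)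
                            (by decide) (by push_cast; exact ⟨by linarith, by linarith, by linarith⟩)⟩
                        · exact ⟨[2, 3], mem_stack_of_triangle (13, 0) (14, 6) (13, 2) (by decide)
                            (by decide) (by push_cast; exact ⟨by linarith, by linarith, by linarith⟩)⟩
                  · exact ⟨[2, 3], mem_stack_of_triangle (13, 0) (24, 0) (14, 6) (by decide)
                      (by decide) (by push_cast; exact ⟨by linarith, by linarith, by linarith⟩)⟩
                · rcases le_total 0 (-6 * a + 18 * b - 1) with h | h
                  · rcases le_total 0 (-3 * a - b + 2) with h | h
                    · rcases le_total 0 (-20 * a - 2 * b + 11) with h | h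
                      · rcases le_total 0 (-96 * a - 36 * b + 55) with h | h
                        · exact ⟨[0, 6, 1], mem_stack_of_triangle (0, 0) (13, 2) (10, 10) (by decide)
                            (by decide) (by push_cast; exact ⟨by linarith, by linarith, by linarith⟩)⟩
                        · exact ⟨[0, 6, 7, 1], mem_stack_of_triangle (13, 2) (12, 12) (10, 10) (by decide)
                            (by decide) (by push_cast; exact ⟨by linarith, by linarith, by linarith⟩)⟩
                      · exact ⟨[0, 3, 6, 7], mem_stack_of_triangle (13, 2) (14, 6) (12, 12) (by decide)
                          (by decide) (by push_cast; exact ⟨by linarith, by linarith, by linarith⟩)⟩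
                    · exact ⟨[3, 6, 7], mem_stack_of_triangle (14, 6) (17, 7) (12, 12) (by decide)
                        (by decide) (by push_cast; exact ⟨by linarith, by linarith, by linarith⟩)⟩
                  · exact ⟨[2, 3], mem_stack_of_triangle (13, 0) (17, 7) (14, 6) (by decide)
                      (by decide) (by push_cast; exact ⟨by linarith, by linarith, by linarith⟩)⟩
          · rcases le_total 0 (3 * a - 15 * b + 5) with h | h
            · exact ⟨[0, 6, 1], mem_stack_of_triangle (12, 0) (10, 10) (0, 8) (by decide)
                (by decide) (by push_cast; exact ⟨by linarith, by linarith, by linarith⟩)⟩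
            · exact ⟨[6, 4, 1], mem_stack_of_triangle (10, 14) (0, 8) (10, 10) (by decide)
                (by decide) (by push_cast; exact ⟨by linarith, by linarith, by linarith⟩)⟩
        · exact ⟨[6, 4, 1], mem_stack_of_triangle (10, 14) (7, 17) (0, 8) (by decide)
            (by decide) (by push_cast; exact ⟨by linarith, by linarith, by linarith⟩)⟩
      · exact ⟨[2, 3], mem_stack_of_triangle (13, 0) (24, 0) (17, 7) (by decide)
          (by decide) (by push_cast; exact ⟨by linarith, by linarith, by linarith⟩)⟩
    · exact ⟨[4, 5], mem_stack_of_triangle (7, 17) (0, 24) (0, 8) (by decide)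
        (by decide) (by push_cast; exact ⟨by linarith, by linarith, by linarith⟩)⟩

theorem unitPrism_subset_iUnion_cell : unitPrism ⊆ ⋃ i, cell i := by
  rintro ⟨⟨a, b⟩, c⟩ ⟨ha, hb, hab, hc0, hc1⟩
  obtain ⟨σ, hσ⟩ := exists_mem_stack ha hb hab
  refine Set.mem_iUnion.2 (exists_mem_of_mem_stack convex_cell hσ ?_ hc0 hc1)
  rintro rfl
  exact zero_ne_one (show (0 : ℝ) = 1 from hσ)

theorem convex_unitPrism : Convex ℝ unitPrism := by
  rintro x ⟨h1, h2, h3, h4, h5⟩ y ⟨k1, k2, k3, k4, k5⟩ p q hp hq hpq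
  simp only [unitPrism, Set.mem_ofPred_eq, Prod.fst_add, Prod.snd_add, Prod.smul_fst,
    Prod.smul_snd, smul_eq_mul]
  refine ⟨by positivity, by positivity, ?_, by positivity, ?_⟩
  · nlinarith
  · nlinarith

theorem unitPrism_eq_convexHull : unitPrism = convexHull ℝ
    {((0, 0), 0), ((1, 0), 0), ((0, 1), 0), ((0, 0), 1), ((1, 0), 1), ((0, 1), 1)} := by
  apply subset_antisymm
  · set C : Set ((ℝ × ℝ) × ℝ) := convexHull ℝ
      {((0, 0), 0), ((1, 0), 0), ((0, 1), 0), ((0, 0), 1), ((1, 0), 1), ((0, 1), 1)} with hC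
    have hconv : ∀ _ : Fin 8, Convex ℝ C := fun _ => convex_convexHull ℝ _
    rintro ⟨⟨a, b⟩, c⟩ ⟨ha, hb, hab, hc0, hc1⟩
    dsimp only at ha hb hab hc0 hc1
    have hvert : ∀ p : ℝ × ℝ, (p, (0 : ℝ)) ∈ C → (p, (1 : ℝ)) ∈ C →
        (p, (0 : ℝ)) ∈ stack (fun _ => C) [0] := fun p h0 h1 => ⟨h0, 1, h1, rfl⟩
    have hbase : Convex ℝ {p : ℝ × ℝ | (p, (0 : ℝ)) ∈ stack (fun _ => C) [0]} := by
      intro x hx y hy s t hs ht hst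
      have := convex_stack hconv [0] hx hy hs ht hst
      simpa using this
    have hmem : ((a, b), (0 : ℝ)) ∈ stack (fun _ => C) [0] := by
      refine mem_of_triangle hbase (p := (0, 0)) (q := (1, 0)) (r := (0, 1)) (x := (a, b))
        (hvert _ ?_ ?_) (hvert _ ?_ ?_) (hvert _ ?_ ?_) ?_ ?_ ?_ ?_
      any_goals exact subset_convexHull ℝ _ (by simp)
      all_goals simp only [cross]; linarith
    obtain ⟨-, h⟩ := exists_mem_of_mem_stack hconv hmem (by simp) hc0 hc1
    exact h
  · refine convexHull_min ?_ convex_unitPrism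
    rintro x (rfl | rfl | rfl | rfl | rfl | rfl) <;> norm_num [unitPrism]

theorem prism_eq_image : prism = heis '' unitPrism := by
  rw [unitPrism_eq_convexHull, LinearMap.image_convexHull, prism]
  congr 1
  simp [Set.image_insert_eq, heis_apply, omega_eq]

theorem cell_subset_unitPrism (i : Fin 8) : cell i ⊆ unitPrism := by
  have hall : ∀ i, ∀ q ∈ vertices i, 0 ≤ q.1.1 ∧ 0 ≤ q.1.2 ∧ q.1.1 + q.1.2 ≤ 24 ∧
      0 ≤ q.2 ∧ q.2 ≤ 72 := by decide
  refine convexHull_min ?_ convex_unitPrism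
  rintro - ⟨q, hq, rfl⟩
  obtain ⟨h1, h2, h3, h4, h5⟩ := hall i q hq
  have h1' : (0 : ℝ) ≤ q.1.1 := by exact_mod_cast h1
  have h2' : (0 : ℝ) ≤ q.1.2 := by exact_mod_cast h2
  have h3' : (q.1.1 + q.1.2 : ℝ) ≤ 24 := by exact_mod_cast h3
  have h4' : (0 : ℝ) ≤ q.2 := by exact_mod_cast h4
  have h5' : (q.2 : ℝ) ≤ 72 := by exact_mod_cast h5
  refine ⟨?_, ?_, ?_, ?_, ?_⟩ <;> simp only [gridPoint] <;> linarith

theorem unitPrism_eq_iUnion_cell : unitPrism = ⋃ i, cell i :=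
  unitPrism_subset_iUnion_cell.antisymm (Set.iUnion_subset cell_subset_unitPrism)

/-! ### The polytopes lie in the Cygan balls -/

/-- The coordinates of the eight centres, in the units of `gridPoint`. -/
def gridCenter : Fin 8 → (ℤ × ℤ) × ℤ :=
  ![((0, 0), 0), ((0, 0), 72), ((24, 0), 0), ((24, 0), 72), ((0, 24), 0), ((0, 24), 72),
    ((8, 8), 24), ((16, 8), 72)]

theorem heis_gridPoint_gridCenter (i : Fin 8) : heis (gridPoint (gridCenter i)) = center i := by
  fin_cases i <;> ext1 <;> simp [heis_apply, gridPoint, gridCenter, center, omega_eq] <;> ring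

theorem cyganQuartic_heis (x y : (ℝ × ℝ) × ℝ) (u : ℝ) :
    cyganQuartic (heis x, u) (heis y) =
      (4 * (x.1.1 - y.1.1) ^ 2 + 2 * (x.1.2 - y.1.2) ^ 2 + u) ^ 2 +
        8 * (x.2 - y.2 + 2 * (x.1.2 * y.1.1 - x.1.1 * y.1.2)) ^ 2 := by
  have hs : √2 ^ 2 = (2 : ℝ) := Real.sq_sqrt (by norm_num)
  have h1 : (heis x).1 - (heis y).1 =
      ((2 * (x.1.1 - y.1.1) : ℝ) : ℂ) + ((x.1.2 - y.1.2 : ℝ) : ℂ) * omega := by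
    simp only [heis_apply]; push_cast; ring
  rw [cyganQuartic, h1, normSq_int_add_omega]
  simp [heis_apply]
  ring_nf
  rw [hs]
  ring

theorem convexOn_sq_of_affine {E : Type*} [AddCommGroup E] [Module ℝ E] {f : E → ℝ}
    (hf : ∀ x y : E, ∀ p q : ℝ, p + q = 1 → f (p • x + q • y) = p * f x + q * f y) :
    ConvexOn ℝ Set.univ fun x => f x ^ 2 := by
  refine ⟨convex_univ, fun x _ y _ p q hp hq hpq => ?_⟩
  have h := mul_nonneg (mul_nonneg hp hq) (sq_nonneg (f x - f y))
  obtain rfl : q = 1 - p := by linarith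
  simp only [hf x y p _ hpq, smul_eq_mul]
  nlinarith

/-- In horospherical coordinates at a fixed height, extended Cygan balls are affinely convex. -/
theorem convexOn_cyganQuartic_heis (y : (ℝ × ℝ) × ℝ) {u : ℝ} (hu : 0 ≤ u) :
    ConvexOn ℝ Set.univ fun x => cyganQuartic (heis x, u) (heis y) := by
  simp only [cyganQuartic_heis]
  have h1 : ConvexOn ℝ Set.univ fun x : (ℝ × ℝ) × ℝ => (x.1.1 - y.1.1) ^ 2 :=
    convexOn_sq_of_affine fun x x' p q hpq => by
      obtain rfl : q = 1 - p := by linarith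
      simp; ring
  have h2 : ConvexOn ℝ Set.univ fun x : (ℝ × ℝ) × ℝ => (x.1.2 - y.1.2) ^ 2 :=
    convexOn_sq_of_affine fun x x' p q hpq => by
      obtain rfl : q = 1 - p := by linarith
      simp; ring
  have h3 : ConvexOn ℝ Set.univ fun x : (ℝ × ℝ) × ℝ =>
      (x.2 - y.2 + 2 * (x.1.2 * y.1.1 - x.1.1 * y.1.2)) ^ 2 :=
    convexOn_sq_of_affine fun x x' p q hpq => by
      obtain rfl : q = 1 - p := by linarith
      simp; ring
  exact ((((h1.smul (by norm_num : (0 : ℝ) ≤ 4)).add (h2.smul zero_le_two)).add_const u).pow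
    (fun x _ => by simp only [Pi.add_apply, smul_eq_mul]; positivity) 2).add
    (h3.smul (by norm_num : (0 : ℝ) ≤ 8))

theorem depth_pos (i : Fin 8) : 0 < (depth i : ℝ) := by
  fin_cases i <;> simp [depth]

/-- The polytope assigned to a ball lies well inside that ball, at height `0.4852`. -/
theorem depth_mul_cyganQuartic_le {i : Fin 8} {x : (ℝ × ℝ) × ℝ} (hx : x ∈ cell i) :
    depth i * cyganQuartic (heis x, 0.4852) (center i) / 4 ≤ 0.999 := by
  -- The inequality at the vertices, with the denominators `576 = 24²`, `2500` and `72` cleared.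
  have hall : ∀ i, ∀ q ∈ vertices i,
      1000 * (depth i : ℤ) * (((4 * (q.1.1 - (gridCenter i).1.1) ^ 2 +
        2 * (q.1.2 - (gridCenter i).1.2) ^ 2) * 2500 + 1213 * 576) ^ 2 +
        8 * (2500 * (8 * (q.2 - (gridCenter i).2) + 2 * (q.1.2 * (gridCenter i).1.1
          - q.1.1 * (gridCenter i).1.2))) ^ 2) ≤ 999 * 4 * 1440000 ^ 2 := by
    decide
  have hconv : Convex ℝ {x | cyganQuartic (heis x, 0.4852) (center i) ≤ 3.996 / depth i} := by
    have := (convexOn_cyganQuartic_heis (gridPoint (gridCenter i))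
      (u := 0.4852) (by norm_num)).convex_le (3.996 / depth i)
    simpa [heis_gridPoint_gridCenter] using this
  have hd := depth_pos i
  have hmem : x ∈ {x | cyganQuartic (heis x, 0.4852) (center i) ≤ 3.996 / depth i} := by
    refine convexHull_min ?_ hconv hx
    rintro - ⟨q, hq, rfl⟩
    have h := hall i q hq
    have h' := (Int.cast_le (R := ℝ)).2 h
    push_cast at h'
    rw [Set.mem_ofPred_eq, le_div_iff₀ hd, ← heis_gridPoint_gridCenter, cyganQuartic_heis]
    simp only [gridPoint]
    linarith
  rw [Set.mem_ofPred_eq, le_div_iff₀ hd] at hmem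
  linarith

theorem cyganQuartic_mono {p q : ℂ × ℝ} {u u' : ℝ} (hu : 0 ≤ u) (h : u ≤ u') :
    cyganQuartic (p, u) q ≤ cyganQuartic (p, u') q := by
  unfold cyganQuartic; gcongr

/-! ### The covering by horoballs and the covering depth -/

/-- A point of height at most `0.4852` has a translate that is higher by a definite factor. -/
theorem exists_smul_horoPoint_higher {w : (ℂ × ℝ) × ℝ} (hw : 0 < w.2) (hw' : w.2 ≤ 0.4852) :
    ∃ γ ∈ picardModularGroup 2, ∃ w' : (ℂ × ℝ) × ℝ, γ • horoPoint w = horoPoint w' ∧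
      w.2 / 0.999 ≤ w'.2 := by
  obtain ⟨δ, hδ, x, hx, hδw⟩ := exists_smul_mem_unitPrism w
  obtain ⟨i, hi⟩ := Set.mem_iUnion.1 (unitPrism_subset_iUnion_cell hx)
  obtain ⟨γ, hγ, z, v, h⟩ := exists_smul_horoPoint_of_center i (w := (heis x, w.2)) hw
  refine ⟨γ * δ, mul_mem hγ hδ, _, by rw [mul_smul, hδw, h], ?_⟩
  have hd := depth_pos i
  have hpos : 0 < cyganQuartic (heis x, w.2) (center i) := by
    unfold cyganQuartic; positivity
  refine div_le_div_of_nonneg_left hw.le (by positivity) ?_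
  refine le_trans ?_ (depth_mul_cyganQuartic_le hi)
  gcongr
  exact cyganQuartic_mono hw.le hw'

theorem horoballTranslatesCover : HoroballTranslatesCover 2 0.4852 := by
  have key : ∀ (k : ℕ) (w : (ℂ × ℝ) × ℝ), 0 < w.2 → 0.4852 * 0.999 ^ k < w.2 →
      ∃ γ ∈ picardModularGroup 2, γ • horoPoint w ∈ horoball 0.4852 := by
    intro k
    induction k with
    | zero =>
      intro w _ hw
      exact ⟨1, one_mem _, w.1.1, w.1.2, w.2, by simpa using hw, by rw [one_smul]⟩
    | succ k ih =>
      intro w hw0 hw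
      rcases lt_or_ge 0.4852 w.2 with h | h
      · exact ⟨1, one_mem _, w.1.1, w.1.2, w.2, h, by rw [one_smul]⟩
      · obtain ⟨γ, hγ, w', hww', hle⟩ := exists_smul_horoPoint_higher hw0 h
        have hlt : 0.4852 * 0.999 ^ k < w.2 / 0.999 := by
          rw [lt_div_iff₀ (by norm_num), mul_assoc, ← pow_succ]; exact hw
        obtain ⟨δ, hδ, hmem⟩ := ih w' ((div_pos hw0 (by norm_num)).trans_le hle) (hlt.trans_le hle)
        exact ⟨δ * γ, mul_mem hδ hγ, by rwa [mul_smul, hww']⟩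
  intro p hp
  obtain ⟨w, hw, rfl⟩ := exists_horoPoint_of_mem_complexHyperbolicPlane hp
  obtain ⟨k, hk⟩ := exists_pow_lt_of_lt_one (show 0 < w.2 / 0.4852 by positivity)
    (show (0.999 : ℝ) < 1 by norm_num)
  rw [lt_div_iff₀ (by norm_num), mul_comm] at hk
  obtain ⟨γ, hγ, hmem⟩ := key k w hw hk
  exact Set.mem_iUnion₂.2 ⟨γ⁻¹, inv_mem hγ, _, hmem, inv_smul_smul γ _⟩

theorem two_div_sqrt_seventeen_lt : 2 / √(17 : ℝ) < 0.4852 := by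
  rw [div_lt_iff₀ (by positivity)]
  have h : (4.1231 : ℝ) < √17 := by
    rw [Real.lt_sqrt (by norm_num)]; norm_num
  linarith

theorem exists_isCoveringHeight : ∃ h, IsCoveringHeight 2 h ∧ 0.4852 ≤ h ∧ h ≤ 2 := by
  have hmem : (0.4852 : ℝ) ∈ {u : ℝ | 0 < u ∧ HoroballTranslatesCover 2 u} :=
    ⟨by norm_num, horoballTranslatesCover⟩
  have hub : (2 : ℝ) ∈ upperBounds {u : ℝ | 0 < u ∧ HoroballTranslatesCover 2 u} :=
    fun u hu => (lt_two_of_horoballTranslatesCover hu.2).le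
  have hlub := isLUB_csSup ⟨_, hmem⟩ ⟨_, hub⟩
  exact ⟨_, hlub, hlub.1 hmem, hlub.2 hub⟩

theorem isCoveringDepth_iff {h : ℝ} (hh : IsCoveringHeight 2 h) (h0 : 0 < h) (n : ℕ) :
    IsCoveringDepth 2 n ↔ 1 ≤ n ∧ n ≤ 4 / h ^ 2 ∧ 4 / h ^ 2 < n + 1 := by
  have hlt : 2 / √((n : ℝ) + 1) < h ↔ 4 / h ^ 2 < n + 1 := by
    rw [div_lt_comm₀ (by positivity) h0, Real.lt_sqrt (by positivity), div_pow]
    norm_num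
  have hle : 1 ≤ n → (h ≤ 2 / √(n : ℝ) ↔ (n : ℝ) ≤ 4 / h ^ 2) := fun hn => by
    have hn' : 0 < √(n : ℝ) := Real.sqrt_pos.2 (by exact_mod_cast hn)
    rw [le_div_comm₀ h0 hn', Real.sqrt_le_left (by positivity), div_pow]
    norm_num
  constructor
  · rintro ⟨hn, h', hh', h1, h2⟩
    obtain rfl := hh'.unique hh
    exact ⟨hn, (hle hn).1 h2, hlt.1 h1⟩
  · rintro ⟨hn, h2, h1⟩
    exact ⟨hn, h, hh, hlt.2 h1, (hle hn).2 h2⟩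

theorem existsUnique_isCoveringDepth : ∃! n : ℕ, IsCoveringDepth 2 n := by
  obtain ⟨h, hh, hlo, hhi⟩ := exists_isCoveringHeight
  have h0 : 0 < h := by linarith
  have hone : 1 ≤ 4 / h ^ 2 := by
    rw [one_le_div (by positivity)]; nlinarith
  have hnn : 0 ≤ 4 / h ^ 2 := by positivity
  refine ⟨⌊4 / h ^ 2⌋₊, (isCoveringDepth_iff hh h0 _).2 ⟨Nat.le_floor (by simpa using hone),
    Nat.floor_le hnn, Nat.lt_floor_add_one _⟩, fun n hn => ?_⟩
  obtain ⟨-, h1, h2⟩ := (isCoveringDepth_iff hh h0 n).1 hn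
  exact ((Nat.floor_eq_iff hnn).2 ⟨h1, h2⟩).symm

theorem isCoveringDepth_le {n : ℕ} (hn : IsCoveringDepth 2 n) : n ≤ 16 := by
  obtain ⟨h, hh, hlo, -⟩ := exists_isCoveringHeight
  obtain ⟨-, h1, -⟩ := (isCoveringDepth_iff hh (by linarith) n).1 hn
  have h2 : 4 / h ^ 2 < 17 := by
    rw [div_lt_iff₀ (by positivity)]; nlinarith
  have : (n : ℝ) < 17 := h1.trans_lt h2
  exact Nat.le_of_lt_succ (by exact_mod_cast this)

/-! ### The prism in horospherical coordinates -/

/-- The vertices, in `ℂ × ℝ`, of the polytope assigned to the ball `i`. -/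
def cellVertices (i : Fin 8) : Finset (ℂ × ℝ) :=
  (((vertices i).finite_toSet.image gridPoint).image heis).toFinset

theorem convexHull_cellVertices (i : Fin 8) :
    convexHull ℝ (cellVertices i : Set (ℂ × ℝ)) = heis '' cell i := by
  rw [cellVertices, Set.Finite.coe_toFinset, cell, LinearMap.image_convexHull]

theorem prism_prod_eq_iUnion : prism ×ˢ {(0.4852 : ℝ)} =
    ⋃ i : Fin 8, convexHull ℝ (cellVertices i : Set (ℂ × ℝ)) ×ˢ {(0.4852 : ℝ)} := by
  simp only [convexHull_cellVertices]
  rw [← Set.iUnion_prod_const, ← Set.image_iUnion, ← unitPrism_eq_iUnion_cell, prism_eq_image]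

theorem convexHull_cellVertices_prod_subset (i : Fin 8) :
    convexHull ℝ (cellVertices i : Set (ℂ × ℝ)) ×ˢ {(0.4852 : ℝ)} ⊆
      extCyganBall (center i) ((4 / (depth i : ℝ)) ^ (1 / 4 : ℝ)) := by
  rw [convexHull_cellVertices]
  rintro ⟨-, u⟩ ⟨⟨x, hx, rfl⟩, rfl⟩
  refine ⟨by norm_num, ?_⟩
  rw [extCyganDist_eq (by norm_num)]
  refine Real.rpow_lt_rpow (cyganQuartic_nonneg _ _) ?_ (by norm_num)
  have h := depth_mul_cyganQuartic_le hx
  rw [lt_div_iff₀ (depth_pos i)]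
  linarith

end PicardModular

end

theorem corollary3 :
    -- the height lies just above `2 / √17`, and the translates of its horoball cover
    2 / √(17 : ℝ) < 0.4852 ∧
    PicardModular.HoroballTranslatesCover 2 0.4852 ∧
    -- the covering depth exists, is unique, and is at most 16
    (∃! n : ℕ, PicardModular.IsCoveringDepth 2 n) ∧
    (∀ n : ℕ, PicardModular.IsCoveringDepth 2 n → n ≤ 16) ∧
    -- the eight centres are rational boundary points of depth 1 or 3
    (∀ i : Fin 8, PicardModular.HasDepth 2
      (PicardModular.horoPoint (PicardModular.center i, 0)) (PicardModular.depth i)) ∧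
    -- eight affine convex hulls of finite sets make up the prism at height 0.4852, and each of
    -- them lies in the corresponding extended Cygan ball
    (∃ S : Fin 8 → Finset (ℂ × ℝ),
      PicardModular.prism ×ˢ {(0.4852 : ℝ)} =
        ⋃ i : Fin 8, convexHull ℝ (S i : Set (ℂ × ℝ)) ×ˢ {(0.4852 : ℝ)} ∧
      ∀ i : Fin 8, convexHull ℝ (S i : Set (ℂ × ℝ)) ×ˢ {(0.4852 : ℝ)} ⊆
        PicardModular.extCyganBall (PicardModular.center i)
          ((4 / (PicardModular.depth i : ℝ)) ^ (1 / 4 : ℝ))) := by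
  exact ⟨PicardModular.two_div_sqrt_seventeen_lt, PicardModular.horoballTranslatesCover,
    PicardModular.existsUnique_isCoveringDepth, fun _ => PicardModular.isCoveringDepth_le,
    PicardModular.hasDepth_center, PicardModular.cellVertices,
    PicardModular.prism_prod_eq_iUnion, PicardModular.convexHull_cellVertices_prod_subset⟩
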